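/- Let $p(n)$ be the number of partitions of $n$, let $p(m,n)$ be the number of partitions of $n$ with exactly $m$ parts, and put $p_2(n)=\sum_m m^2p(m,n)$. The rank of a partition is its largest part minus its number of parts (and $0$ for the empty partition); let $N(m,n)$ be the number of partitions of $n$ with rank $m$, and let $N_2(n)=\sum_{m\in\mathbb Z}m^2N(m,n)$ be the second Atkin–Garvan rank moment. Let $f(n,N)$ be $p(n)$ minus the number of partitions of $n$ all of whose parts are $\le N$. Let $g(n,N)$ be the number of positive divisors of $n$ that are $\le N$ if $n\ge1$, and $g(n,N)=0$ if $n\le 0$. Put $$S(n)=\sum_{k,N\ge1}f(k,N)\,g(n-k,N)$$ (only finitely many terms are nonzero). Write $(q)_n=\prod_{k=1}^{n}(1-q^k)$ and $(q)_\infty=\prod_{k\ge1}(1-q^k)$. Then, as formal power series in $q$ over $\mathbb Q$, the middle series being summable coefficientwise, $$\sum_{n\ge1}S(n)q^n=\sum_{n\ge1}\left(\frac1{(q)_\infty}-\frac1{(q)_n}\right)\sum_{i=1}^{n}\frac{q^i}{1-q^i}=\sum_{n\ge1}\left(p_2(n)-n\,p(n)-\tfrac12N_2(n)\right)q^n.$$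 -/

import Mathlib

open scoped PowerSeries PowerSeries.WithPiTopology

namespace RankMoment

/-- `p(n)`, the number of partitions of `n`. -/
def p (n : ℕ) : ℕ := Fintype.card n.Partition

/-- `p(m,n)`, the number of partitions of `n` with exactly `m` parts. -/
def pParts (m n : ℕ) : ℕ :=
  (Finset.univ.filter fun l : n.Partition => l.parts.card = m).card

theorem pParts_eq_zero {m n : ℕ} (h : n < m) : pParts m n = 0 := by
  unfold pParts
  rw [Finset.card_eq_zero, Finset.filter_eq_empty_iff]
  intro l _ hl
  have h1 : l.parts.card • 1 ≤ l.parts.sum :=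
    Multiset.card_nsmul_le_sum fun x hx => l.parts_pos hx
  rw [l.parts_sum, smul_eq_mul, mul_one] at h1
  omega

/-- `p₂(n) = ∑ₘ m² p(m,n)`, over all `m`; `finite_support_p₂` shows that only finitely many
terms are nonzero. -/
noncomputable def p₂ (n : ℕ) : ℕ := ∑ᶠ m : ℕ, m ^ 2 * pParts m n

theorem finite_support_p₂ (n : ℕ) :
    (Function.support fun m : ℕ => m ^ 2 * pParts m n).Finite := by
  refine (Set.finite_Iic n).subset fun m hm => ?_
  by_contra h
  exact hm (by simp [pParts_eq_zero (not_le.mp h)])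

/-- The (Dyson) rank of a partition: its largest part minus its number of parts.
The empty partition of `0` has rank `0`. -/
def rank {n : ℕ} (l : n.Partition) : ℤ := (l.parts.sup : ℤ) - (l.parts.card : ℤ)

/-- `N(m,n)`, the number of partitions of `n` with rank `m`. -/
def rankCount (m : ℤ) (n : ℕ) : ℕ :=
  (Finset.univ.filter fun l : n.Partition => rank l = m).card

/-- The second rank moment of Atkin and Garvan, `N₂(n) = ∑ₘ m² N(m,n)`, over all integers `m`;
`finite_support_N₂` shows that only finitely many terms are nonzero. -/
noncomputable def N₂ (n : ℕ) : ℤ := ∑ᶠ m : ℤ, m ^ 2 * (rankCount m n : ℤ)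

theorem finite_support_N₂ (n : ℕ) :
    (Function.support fun m : ℤ => m ^ 2 * (rankCount m n : ℤ)).Finite := by
  refine (Set.finite_range fun l : n.Partition => rank l).subset fun m hm => ?_
  by_contra h
  refine hm ?_
  have h0 : rankCount m n = 0 := by
    unfold rankCount
    rw [Finset.card_eq_zero, Finset.filter_eq_empty_iff]
    exact fun l _ hl => h ⟨l, hl⟩
  simp [h0]

/-- `f(n,N)`: `p(n)` minus the number of partitions of `n` all of whose parts are `≤ N`. -/
def f (n N : ℕ) : ℤ := (p n : ℤ) - ((Nat.Partition.restricted n (· ≤ N)).card : ℤ)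

theorem f_eq_zero {n N : ℕ} (h : n ≤ N) : f n N = 0 := by
  have h1 : Nat.Partition.restricted n (· ≤ N) = Finset.univ := by
    ext l
    simp only [Nat.Partition.restricted, Finset.mem_filter, Finset.mem_univ, true_and, iff_true]
    exact fun i hi => (l.le_of_mem_parts hi).trans h
  simp [f, p, h1, Finset.card_univ]

/-- `g(n,N)`: the number of positive divisors `d ≤ N` of the positive integer `n`. As in the
generating function `∑ g(n,N) qⁿ = ∑_{1 ≤ i ≤ N} qⁱ/(1 - qⁱ)`, it is `0` for `n ≤ 0`. -/
def g (n : ℤ) (N : ℕ) : ℕ :=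
  if 0 < n then ((Finset.Icc 1 N).filter fun d : ℕ => (d : ℤ) ∣ n).card else 0

/-- `S(n) = ∑_{k,N ≥ 1} f(k,N) g(n-k,N)`; `finite_support_S` shows that only finitely many
terms are nonzero. -/
noncomputable def S (n : ℕ) : ℤ :=
  ∑ᶠ x : ℕ+ × ℕ+, f x.1 x.2 * (g ((n : ℤ) - ((x.1 : ℕ) : ℤ)) x.2 : ℤ)

theorem finite_support_S (n : ℕ) :
    (Function.support fun x : ℕ+ × ℕ+ =>
      f x.1 x.2 * (g ((n : ℤ) - ((x.1 : ℕ) : ℤ)) x.2 : ℤ)).Finite := by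
  refine Set.Finite.subset (s := Set.Iic (n.succPNat, n.succPNat)) (Set.finite_Iic _) ?_
  rintro ⟨k, N⟩ hx
  simp only [Function.mem_support, ne_eq, mul_eq_zero, not_or] at hx
  have hk : (k : ℕ) < n := by
    by_contra h
    exact hx.2 (by rw [g, if_neg (by omega)]; rfl)
  have hN : (N : ℕ) < k := by
    by_contra h
    exact hx.1 (f_eq_zero (not_lt.mp h))
  refine ⟨?_, ?_⟩ <;> rw [← PNat.coe_le_coe] <;> simp <;> omega

/-- `(a)_n = (a;q)_n = ∏_{0 ≤ k ≤ n-1} (1 - a qᵏ)` as a formal power series in `q = X`. -/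
noncomputable def qPoch (a : ℚ⟦X⟧) (n : ℕ) : ℚ⟦X⟧ :=
  ∏ k ∈ Finset.range n, (1 - a * PowerSeries.X ^ k)

/-- `(a)_∞ = ∏_{k ≥ 0} (1 - a qᵏ)`, the limit being coefficientwise. -/
noncomputable def qPochInf (a : ℚ⟦X⟧) : ℚ⟦X⟧ := ∏' k : ℕ, (1 - a * PowerSeries.X ^ k)

theorem multipliable_qPochInf_X :
    Multipliable fun k : ℕ => (1 - PowerSeries.X * PowerSeries.X ^ k : ℚ⟦X⟧) := by
  simpa only [pow_succ'] using PowerSeries.WithPiTopology.multipliable_one_sub_X_pow ℚ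

/-- The formal power series `∑_{n ≥ 1} a(n) qⁿ`. -/
def series (a : ℕ → ℚ) : ℚ⟦X⟧ := PowerSeries.mk fun n => if 1 ≤ n then a n else 0

/-- The term `(1/(q)_∞ - 1/(q)_n) ∑_{i=1}^n qⁱ/(1 - qⁱ)`. All the series that are inverted have
constant coefficient `1`, so that `⁻¹` is the inverse in the ring of power series. -/
noncomputable def tailTerm (n : ℕ) : ℚ⟦X⟧ :=
  ((qPochInf PowerSeries.X)⁻¹ - (qPoch PowerSeries.X n)⁻¹) *
    ∑ i ∈ Finset.Icc 1 n, PowerSeries.X ^ i * (1 - PowerSeries.X ^ i)⁻¹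

end RankMoment

/-! Everything reduces to one sum over the partitions `l` of `n`, with `L` the largest part and `c`
the number of parts. Expanding `(L - c) ^ 2` and using that conjugation swaps `L` and `c` gives `N₂
= 2 p₂ - 2 ∑ L c` (`N₂_add_two_mul_sum`), so the right-hand coefficient is `∑ (L c - n)`. On the
other side `f(k,N)` counts partitions with a part above `N`. Adding `j` copies of a part `i ≤ N`
preserves this, so the share of a fixed `N` in `S n` counts the parts `≤ N` of the partitions with
`N < L` (`partialS_eq_sum`). Summing over `N < L`, a part `a` is counted `L - a` times, which again
totals `∑ (L c - n)` (`sum_partialS`). That share is also the coefficient of `tailTerm N`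
(`coeff_tailTerm`). -/

namespace YoungDiagram

theorem sum_rowLens (μ : YoungDiagram) : μ.rowLens.sum = μ.card := by
  have h : ∀ c ∈ μ.cells, c.1 ∈ Finset.range (μ.colLen 0) := fun c hc => by
    rw [Finset.mem_range, ← mem_iff_lt_colLen]
    exact μ.up_left_mem le_rfl (Nat.zero_le c.2) hc
  rw [YoungDiagram.card, Finset.card_eq_sum_card_fiberwise h, rowLens,
    ← List.sum_toFinset _ List.nodup_range, List.toFinset_range]
  exact Finset.sum_congr rfl fun i _ => μ.rowLen_eq_card

theorem card_transpose (μ : YoungDiagram) : μ.transpose.card = μ.card := by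
  simp [YoungDiagram.card, transpose]

theorem sup_rowLens (μ : YoungDiagram) : (μ.rowLens : Multiset ℕ).sup = μ.rowLen 0 := by
  refine le_antisymm (Multiset.sup_le.2 fun a ha => ?_) ?_
  · simp only [rowLens, Multiset.mem_coe, List.mem_map] at ha
    obtain ⟨i, -, rfl⟩ := ha
    exact μ.rowLen_anti 0 i (Nat.zero_le i)
  · rcases Nat.eq_zero_or_pos (μ.rowLen 0) with h | h
    · simp [h]
    · refine Multiset.le_sup (Multiset.mem_coe.2 (List.mem_map.2 ⟨0, ?_, rfl⟩))
      rwa [List.mem_range, ← mem_iff_lt_colLen, mem_iff_lt_rowLen]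

end YoungDiagram

/-! ### Conjugation and removal of repeated parts -/

namespace Nat.Partition

/-- The Young diagram whose rows are the parts of a partition. -/
def toYoungDiagram {n : ℕ} (l : n.Partition) : YoungDiagram :=
  YoungDiagram.ofRowLens (l.parts.sort (· ≥ ·)) (l.parts.pairwise_sort (· ≥ ·)).sortedGE

theorem rowLens_toYoungDiagram {n : ℕ} (l : n.Partition) :
    l.toYoungDiagram.rowLens = l.parts.sort (· ≥ ·) :=
  YoungDiagram.rowLens_ofRowLens_eq_self fun _ hx => l.parts_pos ((Multiset.mem_sort _).1 hx)

theorem coe_rowLens_toYoungDiagram {n : ℕ} (l : n.Partition) :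
    (l.toYoungDiagram.rowLens : Multiset ℕ) = l.parts := by
  rw [rowLens_toYoungDiagram, Multiset.sort_eq]

theorem card_toYoungDiagram {n : ℕ} (l : n.Partition) : l.toYoungDiagram.card = n := by
  rw [← YoungDiagram.sum_rowLens, ← Multiset.sum_coe, coe_rowLens_toYoungDiagram, l.parts_sum]

/-- The conjugate partition, obtained by transposing the Young diagram. -/
def conj {n : ℕ} (l : n.Partition) : n.Partition where
  parts := l.toYoungDiagram.transpose.rowLens
  parts_pos h := YoungDiagram.pos_of_mem_rowLens _ _ h
  parts_sum := by
    rw [Multiset.sum_coe, YoungDiagram.sum_rowLens, YoungDiagram.card_transpose,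
      card_toYoungDiagram]

theorem toYoungDiagram_conj {n : ℕ} (l : n.Partition) :
    l.conj.toYoungDiagram = l.toYoungDiagram.transpose := by
  apply YoungDiagram.equivListRowLens.injective
  refine Subtype.ext ?_
  simp only [YoungDiagram.equivListRowLens_apply_coe, rowLens_toYoungDiagram, conj,
    Multiset.coe_sort]
  exact List.mergeSort_eq_self _ (by
    simpa using (YoungDiagram.rowLens_sorted l.toYoungDiagram.transpose).pairwise)

theorem conj_involutive {n : ℕ} : Function.Involutive (conj (n := n)) := fun l => by
  ext1
  change (l.conj.toYoungDiagram.transpose.rowLens : Multiset ℕ) = l.parts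
  rw [toYoungDiagram_conj, YoungDiagram.transpose_transpose, coe_rowLens_toYoungDiagram]

theorem card_parts_conj {n : ℕ} (l : n.Partition) : l.conj.parts.card = l.parts.sup := by
  rw [conj, Multiset.coe_card, YoungDiagram.length_rowLens, YoungDiagram.colLen_transpose,
    ← YoungDiagram.sup_rowLens, coe_rowLens_toYoungDiagram]

theorem sum_sup_parts_eq_sum_card_parts {M : Type*} [AddCommMonoid M] (n : ℕ) (w : ℕ → M) :
    ∑ l : n.Partition, w l.parts.sup = ∑ l : n.Partition, w l.parts.card :=
  Fintype.sum_equiv (Function.Involutive.toPerm conj conj_involutive) _ _ fun l => by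
    rw [Function.Involutive.coe_toPerm, card_parts_conj]

theorem mul_le_of_le_count {n i j : ℕ} {l : n.Partition} (h : j ≤ l.parts.count i) :
    i * j ≤ n := by
  obtain ⟨u, hu⟩ := Multiset.le_iff_exists_add.1 (Multiset.le_count_iff_replicate_le.1 h)
  have := congrArg Multiset.sum hu
  rw [l.parts_sum, Multiset.sum_add, Multiset.sum_replicate, smul_eq_mul, mul_comm] at this
  omega

/-- Removing `j` copies of `i ≤ N` does not change whether some part exceeds `N`. -/
theorem card_filter_le_count (m i j N : ℕ) (hi : 0 < i) (hN : i ≤ N) :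
    (Finset.univ.filter fun l : (m + i * j).Partition =>
      N < l.parts.sup ∧ j ≤ l.parts.count i).card =
    (Finset.univ.filter fun l : m.Partition => N < l.parts.sup).card := by
  have hsup (s : Multiset ℕ) : N < (s + Multiset.replicate j i).sup ↔ N < s.sup := by
    have : (Multiset.replicate j i).sup ≤ N :=
      Multiset.sup_le.2 fun a ha => (Multiset.eq_of_mem_replicate ha).trans_le hN
    rw [Multiset.sup_add, lt_sup_iff]
    omega
  have hsub {l : (m + i * j).Partition} (h : j ≤ l.parts.count i) :
      l.parts - Multiset.replicate j i + Multiset.replicate j i = l.parts :=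
    tsub_add_cancel_of_le (Multiset.le_count_iff_replicate_le.1 h)
  symm
  refine Finset.card_bij' (fun l _ => ⟨l.parts + Multiset.replicate j i, ?_, ?_⟩)
    (fun l hl => ⟨l.parts - Multiset.replicate j i, ?_, ?_⟩) ?_ ?_ ?_ ?_
  · intro a ha
    rcases Multiset.mem_add.1 ha with ha | ha
    · exact l.parts_pos ha
    · rwa [Multiset.eq_of_mem_replicate ha]
  · simp [l.parts_sum, mul_comm]
  · exact fun ha => l.parts_pos (Multiset.mem_of_le tsub_le_self ha)
  · have := congrArg Multiset.sum (hsub (Finset.mem_filter.1 hl).2.2)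
    rw [Multiset.sum_add, l.parts_sum, Multiset.sum_replicate, smul_eq_mul, mul_comm j] at this
    omega
  · intro l hl
    simp only [Finset.mem_filter, Finset.mem_univ, true_and] at hl ⊢
    exact ⟨(hsup _).2 hl, by simp⟩
  · intro l hl
    simp only [Finset.mem_filter, Finset.mem_univ, true_and] at hl ⊢
    rw [← hsub hl.2, hsup] at hl
    exact hl.1
  · intro l hl
    ext1
    simp
  · intro l hl
    ext1
    exact hsub (Finset.mem_filter.1 hl).2.2

end Nat.Partition

/-! ### Counting by fibres and by parts -/

theorem finsum_mul_card_fiber {α β : Type*} [Fintype α] [DecidableEq β] {R : Type*}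
    [CommSemiring R] (r : α → β) (w : β → R) :
    ∑ᶠ b, w b * ((Finset.univ.filter fun a => r a = b).card : R) = ∑ a, w (r a) := by
  rw [Finset.sum_comp w r, finsum_eq_sum_of_support_subset (s := Finset.univ.image r)]
  · exact Finset.sum_congr rfl fun b _ => by rw [nsmul_eq_mul, mul_comm]
  · intro b hb
    by_contra h
    refine hb ?_
    have : (Finset.univ.filter fun a => r a = b) = ∅ :=
      Finset.filter_eq_empty_iff.2 fun a _ ha => h (by simp [← ha])
    simp [this]

/-- Each element `a` is counted for the `L - a` values `N ∈ [a, L)`; the additive form avoids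
truncated subtraction. -/
theorem Multiset.sum_card_filter_le (s : Multiset ℕ) (L : ℕ) (h : ∀ a ∈ s, a ≤ L) :
    ∑ N ∈ Finset.range L, (s.filter (· ≤ N)).card + s.sum = L * s.card := by
  induction s using Multiset.induction with
  | empty => simp
  | cons a s ih =>
    have ih := ih fun b hb => h b (Multiset.mem_cons_of_mem hb)
    have ha := h a (Multiset.mem_cons_self a s)
    have h1 : ∀ N, ((a ::ₘ s).filter (· ≤ N)).card =
        (s.filter (· ≤ N)).card + if a ≤ N then 1 else 0 := fun N => by
      by_cases hN : a ≤ N <;> simp [hN]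
    have h2 : ∑ N ∈ Finset.range L, (if a ≤ N then 1 else 0) = L - a := by
      rw [← Finset.card_filter, ← Nat.card_Ico]
      congr 1
      ext N
      simp [and_comm]
    simp only [h1, Finset.sum_add_distrib, h2, Multiset.sum_cons, Multiset.card_cons, mul_add]
    omega

theorem Multiset.card_filter_le_eq_sum_count (s : Multiset ℕ) (h : ∀ a ∈ s, 0 < a) (N : ℕ) :
    (s.filter (· ≤ N)).card = ∑ i ∈ Finset.Icc 1 N, s.count i := by
  rw [← Multiset.sum_count_eq_card (s := Finset.Icc 1 N)]
  · refine Finset.sum_congr rfl fun i hi => ?_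
    rw [Multiset.count_filter, if_pos (Finset.mem_Icc.1 hi).2]
  · intro a ha
    rw [Multiset.mem_filter] at ha
    exact Finset.mem_Icc.2 ⟨h a ha.1, ha.2⟩

/-! ### Rank moments and `S` as sums over partitions -/

namespace RankMoment

theorem p₂_eq_sum (n : ℕ) : p₂ n = ∑ l : n.Partition, l.parts.card ^ 2 :=
  finsum_mul_card_fiber (fun l : n.Partition => l.parts.card) fun m : ℕ => m ^ 2

theorem N₂_eq_sum (n : ℕ) : N₂ n = ∑ l : n.Partition, rank l ^ 2 :=
  finsum_mul_card_fiber (fun l : n.Partition => rank l) fun m : ℤ => m ^ 2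

theorem N₂_add_two_mul_sum (n : ℕ) :
    N₂ n + 2 * ∑ l : n.Partition, (l.parts.sup * l.parts.card : ℤ) = 2 * p₂ n := by
  have h := Nat.Partition.sum_sup_parts_eq_sum_card_parts n fun m => (m : ℤ) ^ 2
  rw [N₂_eq_sum, p₂_eq_sum]
  push_cast
  -- Only one of the two copies is conjugated, completing the square `(L - c) ^ 2 + 2 L c = L ^ 2 +
  -- c ^ 2`.
  rw [two_mul (∑ l : n.Partition, (l.parts.card : ℤ) ^ 2)]
  nth_rewrite 1 [← h]
  rw [Finset.mul_sum, ← Finset.sum_add_distrib, ← Finset.sum_add_distrib]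
  exact Finset.sum_congr rfl fun l _ => by rw [rank]; ring

theorem f_eq_card (n N : ℕ) :
    f n N = (Finset.univ.filter fun l : n.Partition => N < l.parts.sup).card := by
  have h := Finset.card_filter_add_card_filter_not (s := (Finset.univ : Finset n.Partition))
    (fun l => l.parts.sup ≤ N)
  simp only [not_le, Finset.card_univ] at h
  have h' : Nat.Partition.restricted n (· ≤ N) =
      Finset.univ.filter fun l : n.Partition => l.parts.sup ≤ N := by
    ext l
    simp [Nat.Partition.restricted]
  rw [f, p, h', ← h]
  push_cast
  ring

theorem sum_Icc_dvd_eq {M : Type*} [AddCommMonoid M] (n i : ℕ) (hi : 0 < i) (F : ℕ → M) :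
    ∑ m ∈ (Finset.Icc 1 n).filter (i ∣ ·), F m =
      ∑ j ∈ (Finset.Icc 1 n).filter (i * · ≤ n), F (i * j) := by
  symm
  refine Finset.sum_bij (fun j _ => i * j) ?_ ?_ ?_ fun _ _ => rfl
  · intro j hj
    simp only [Finset.mem_filter, Finset.mem_Icc] at hj ⊢
    exact ⟨⟨Nat.mul_pos hi hj.1.1, hj.2⟩, dvd_mul_right i j⟩
  · exact fun a _ b _ h => Nat.eq_of_mul_eq_mul_left hi h
  · intro m hm
    simp only [Finset.mem_filter, Finset.mem_Icc] at hm
    obtain ⟨⟨h1, h2⟩, j, rfl⟩ := hm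
    refine ⟨j, ?_, rfl⟩
    simp only [Finset.mem_filter, Finset.mem_Icc]
    exact ⟨⟨Nat.pos_of_mul_pos_left h1, (Nat.le_mul_of_pos_left j hi).trans h2⟩, h2⟩

/-- The part of `S n` belonging to a fixed `N`. -/
def partialS (n N : ℕ) : ℤ := ∑ m ∈ Finset.Icc 1 n, f (n - m) N * g m N

/-- Double counting of triples `(l, i, j)` with `N < l.parts.sup`, `i ≤ N` and `1 ≤ j ≤
l.parts.count i`, where `m = i * j` is the size of the removed block. -/
theorem partialS_eq_sum (n N : ℕ) :
    partialS n N = ∑ l : n.Partition,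
      if N < l.parts.sup then ((l.parts.filter (· ≤ N)).card : ℤ) else 0 := by
  have hg : ∀ m ∈ Finset.Icc 1 n, f (n - m) N * g m N =
      ∑ i ∈ Finset.Icc 1 N, if i ∣ m then f (n - m) N else 0 := fun m hm => by
    have : (0 : ℤ) < m := by exact_mod_cast (Finset.mem_Icc.1 hm).1
    rw [g, if_pos this, Finset.card_filter, Nat.cast_sum, Finset.mul_sum]
    exact Finset.sum_congr rfl fun i _ => by simp [Int.natCast_dvd_natCast]
  have hc : ∀ (l : n.Partition) (i : ℕ), 0 < i → l.parts.count i =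
      ∑ j ∈ Finset.Icc 1 n, if j ≤ l.parts.count i then 1 else 0 := fun l i hi => by
    have hle : l.parts.count i ≤ n :=
      (Nat.le_mul_of_pos_left _ hi).trans (Nat.Partition.mul_le_of_le_count le_rfl)
    rw [← Finset.card_filter]
    conv_lhs => rw [← Nat.add_sub_cancel (l.parts.count i) 1, ← Nat.card_Icc]
    congr 1
    ext j
    simp only [Finset.mem_Icc, Finset.mem_filter]
    omega
  have hcard : ∀ i ∈ Finset.Icc 1 N, ∀ j ∈ Finset.Icc 1 n,
      ((Finset.univ.filter fun l : n.Partition =>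
        N < l.parts.sup ∧ j ≤ l.parts.count i).card : ℤ) =
      if i * j ≤ n then f (n - i * j) N else 0 := fun i hi j _ => by
    obtain ⟨hi, hN⟩ := Finset.mem_Icc.1 hi
    split_ifs with h
    · obtain ⟨m, rfl⟩ := Nat.exists_eq_add_of_le' h
      rw [Nat.Partition.card_filter_le_count m i j N hi hN, f_eq_card, Nat.add_sub_cancel]
    · rw [Nat.cast_eq_zero, Finset.card_eq_zero, Finset.filter_eq_empty_iff]
      rintro l - ⟨-, hl⟩
      exact h (Nat.Partition.mul_le_of_le_count hl)
  calc partialS n N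
      = ∑ i ∈ Finset.Icc 1 N, ∑ j ∈ Finset.Icc 1 n, if i * j ≤ n then f (n - i * j) N else 0 := by
        rw [partialS, Finset.sum_congr rfl hg, Finset.sum_comm]
        refine Finset.sum_congr rfl fun i hi => ?_
        rw [← Finset.sum_filter, ← Finset.sum_filter,
          sum_Icc_dvd_eq n i (Finset.mem_Icc.1 hi).1 fun m => f (n - m) N]
    _ = ∑ i ∈ Finset.Icc 1 N, ∑ j ∈ Finset.Icc 1 n, ∑ l : n.Partition,
          if N < l.parts.sup ∧ j ≤ l.parts.count i then 1 else 0 := by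
        refine Finset.sum_congr rfl fun i hi => Finset.sum_congr rfl fun j hj => ?_
        rw [← hcard i hi j hj, Finset.card_filter]
        push_cast
        rfl
    _ = ∑ i ∈ Finset.Icc 1 N, ∑ l : n.Partition, ∑ j ∈ Finset.Icc 1 n,
          if N < l.parts.sup ∧ j ≤ l.parts.count i then 1 else 0 :=
        Finset.sum_congr rfl fun i _ => Finset.sum_comm
    _ = ∑ l : n.Partition, ∑ i ∈ Finset.Icc 1 N, ∑ j ∈ Finset.Icc 1 n,
          if N < l.parts.sup ∧ j ≤ l.parts.count i then 1 else 0 := Finset.sum_comm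
    _ = _ := by
        refine Finset.sum_congr rfl fun l _ => ?_
        split_ifs with h
        · rw [Multiset.card_filter_le_eq_sum_count _ (fun a ha => l.parts_pos ha), Nat.cast_sum]
          refine Finset.sum_congr rfl fun i hi => ?_
          have hi := congrArg (Nat.cast (R := ℤ)) (hc l i (Finset.mem_Icc.1 hi).1)
          push_cast at hi
          simpa only [h, true_and] using hi.symm
        · simp [h]

theorem sup_parts_le {n : ℕ} (l : n.Partition) : l.parts.sup ≤ n :=
  Multiset.sup_le.2 fun _ ha => l.le_of_mem_parts ha

theorem sum_partialS (n : ℕ) :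
    ∑ N ∈ Finset.range n, partialS n N =
      ∑ l : n.Partition, (l.parts.sup * l.parts.card : ℤ) - n * p n := by
  simp only [partialS_eq_sum]
  rw [Finset.sum_comm, eq_sub_iff_add_eq]
  have : (n * p n : ℤ) = ∑ l : n.Partition, (n : ℤ) := by simp [p, mul_comm]
  rw [this, ← Finset.sum_add_distrib]
  refine Finset.sum_congr rfl fun l _ => ?_
  have h := l.parts.sum_card_filter_le l.parts.sup fun a ha => Multiset.le_sup ha
  rw [l.parts_sum] at h
  rw [← Finset.sum_filter]
  have h' : (Finset.range n).filter (· < l.parts.sup) = Finset.range l.parts.sup := by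
    ext N
    have := sup_parts_le l
    simp only [Finset.mem_filter, Finset.mem_range]
    omega
  rw [h']
  exact_mod_cast h

theorem partialS_zero_right (n : ℕ) : partialS n 0 = 0 :=
  Finset.sum_eq_zero fun m _ => by simp [g]

theorem partialS_eq_zero {n N : ℕ} (h : n ≤ N) : partialS n N = 0 :=
  Finset.sum_eq_zero fun m _ => by rw [f_eq_zero ((Nat.sub_le n m).trans h), zero_mul]

theorem S_eq_sum_partialS (n : ℕ) : S n = ∑ N ∈ Finset.range n, partialS n N := by
  let F : ℕ × ℕ → ℤ := fun x => f x.1 x.2 * g ((n : ℤ) - (x.1 : ℤ)) x.2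
  let e : ℕ+ × ℕ+ → ℕ × ℕ := fun x => (x.1, x.2)
  have he : Function.Injective e := fun x y h => by
    simpa [e, Prod.ext_iff] using h
  -- Allowing `k = 0` or `N = 0` adds nothing: `f 0 N = 0` and `g _ 0 = 0`.
  have hrange : Function.support F ⊆ Set.range e := by
    rintro ⟨k, N⟩ h
    have hk : 0 < k := by
      by_contra hk
      exact h (by simp [F, f_eq_zero (n := k) (N := N) (by omega)])
    have hN : 0 < N := by
      by_contra hN
      obtain rfl : N = 0 := by omega
      exact h (by simp [F, g])
    exact ⟨(⟨k, hk⟩, ⟨N, hN⟩), rfl⟩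
  have hsupp : Function.support F ⊆ ↑(Finset.range n ×ˢ Finset.range n) := by
    rintro ⟨k, N⟩ h
    have hk : k < n := by
      by_contra hk
      exact h (by simp only [F]; rw [g, if_neg (by omega)]; simp)
    have hN : N < k := by
      by_contra hN
      exact h (by simp [F, f_eq_zero (not_lt.1 hN)])
    simp only [Finset.coe_product, Finset.coe_range, Set.mem_prod, Set.mem_Iio]
    omega
  calc S n = ∑ᶠ x, F (e x) := rfl
    _ = ∑ᶠ x ∈ Set.range e, F x := (finsum_mem_range he).symm
    _ = ∑ᶠ x, F x := by
        rw [← finsum_mem_univ F]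
        exact finsum_mem_inter_support_eq F _ _ (by
          rw [Set.univ_inter, Set.inter_eq_right.2 hrange])
    _ = ∑ N ∈ Finset.range n, ∑ k ∈ Finset.range n, F (k, N) := by
        rw [finsum_eq_sum_of_support_subset F hsupp, Finset.sum_product_right]
    _ = _ := by
        refine Finset.sum_congr rfl fun N _ => ?_
        refine Finset.sum_nbij' (fun k => n - k) (fun m => n - m) ?_ ?_ ?_ ?_ ?_
        all_goals intro k hk
        all_goals simp only [Finset.mem_range, Finset.mem_Icc] at hk ⊢
        any_goals omega
        rw [Nat.cast_sub hk.le, Nat.sub_sub_self hk.le]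

theorem S_eq (n : ℕ) : (S n : ℚ) = p₂ n - n * p n - 1 / 2 * N₂ n := by
  have h1 := N₂_add_two_mul_sum n
  have h2 := sum_partialS n
  rw [← S_eq_sum_partialS] at h2
  have h : 2 * S n = 2 * p₂ n - 2 * (n * p n) - N₂ n := by linarith
  have h' : (2 * S n : ℚ) = 2 * p₂ n - 2 * (n * p n) - N₂ n := by exact_mod_cast h
  linarith

/-! ### Generating functions -/

open PowerSeries

/-- The product being `1` forces a nonzero constant coefficient, so `⁻¹` is not the default value
`0`. -/
theorem inv_eq_of_mul_eq_one {A B : ℚ⟦X⟧} (h : B * A = 1) : A⁻¹ = B := by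
  refine ((PowerSeries.eq_inv_iff_mul_eq_one fun h0 => ?_).2 h).symm
  simpa [h0] using congrArg constantCoeff h

/-- Euler's product: multiplied factor by factor, each geometric series cancels its `1 - X ^ (i +
1)`, and limits are unique. -/
theorem inv_qPochInf_X : (qPochInf X)⁻¹ = mk fun n => (p n : ℚ) := by
  refine inv_eq_of_mul_eq_one ?_
  have h := (Nat.Partition.hasProd_powerSeriesMk_card_restricted ℚ fun _ => True).mul
    multipliable_qPochInf_X.hasProd
  have h1 (i : ℕ) : (∑' j : ℕ, (X : ℚ⟦X⟧) ^ ((i + 1) * j)) * (1 - X * X ^ i) = 1 := by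
    simp only [pow_mul, ← pow_succ']
    exact WithPiTopology.tsum_pow_mul_one_sub_of_constantCoeff_eq_zero (by simp)
  simp only [if_true, h1] at h
  simpa [Nat.Partition.restricted, p, qPochInf] using h.unique hasProd_one

theorem inv_qPoch_X (N : ℕ) :
    (qPoch X N)⁻¹ = mk fun n => ((Nat.Partition.restricted n (· ≤ N)).card : ℚ) := by
  refine inv_eq_of_mul_eq_one ?_
  have h := (Nat.Partition.hasProd_powerSeriesMk_card_restricted ℚ (· ≤ N)).unique
    (hasProd_prod_of_ne_finset_one (s := Finset.range N) fun i hi =>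
      if_neg fun h' => hi (Finset.mem_range.2 h'))
  rw [h, qPoch, ← Finset.prod_mul_distrib]
  refine Finset.prod_eq_one fun i hi => ?_
  rw [if_pos (Nat.succ_le_of_lt (Finset.mem_range.1 hi))]
  simp only [pow_mul, ← pow_succ']
  exact WithPiTopology.tsum_pow_mul_one_sub_of_constantCoeff_eq_zero (by simp)

theorem X_pow_mul_inv_one_sub_X_pow {i : ℕ} (hi : 0 < i) :
    (X : ℚ⟦X⟧) ^ i * (1 - X ^ i)⁻¹ = mk fun n => if 0 < n ∧ i ∣ n then 1 else 0 := by
  rw [eq_comm, PowerSeries.eq_mul_inv_iff_mul_eq (by simp [hi.ne'])]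
  ext n
  rw [mul_sub, mul_one, map_sub, coeff_mul_X_pow', coeff_mk, coeff_X_pow]
  rcases lt_trichotomy n i with h | rfl | h
  · rw [if_neg fun h' => h.not_ge (Nat.le_of_dvd h'.1 h'.2), if_neg h.not_ge, if_neg h.ne, sub_zero]
  · simp [hi]
  · obtain ⟨m, rfl⟩ := Nat.exists_eq_add_of_le' h.le
    have hm : 0 < m := by omega
    simp [hm, hm.ne']

theorem coeff_tailTerm (n N : ℕ) : coeff n (tailTerm N) = (partialS n N : ℚ) := by
  have h1 : (qPochInf X)⁻¹ - (qPoch X N)⁻¹ = mk fun n => (f n N : ℚ) := by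
    rw [inv_qPochInf_X, inv_qPoch_X]
    ext n
    simp [f]
  have h2 : ∑ i ∈ Finset.Icc 1 N, (X : ℚ⟦X⟧) ^ i * (1 - X ^ i)⁻¹ =
      mk fun n => (g (n : ℤ) N : ℚ) := by
    rw [Finset.sum_congr rfl fun i hi =>
      X_pow_mul_inv_one_sub_X_pow (Finset.mem_Icc.1 hi).1]
    ext n
    rw [map_sum, coeff_mk, g]
    rcases Nat.eq_zero_or_pos n with rfl | hn
    · simp
    · simp [hn, Int.natCast_dvd_natCast]
  -- The `m = 0` term of the convolution is split off; it vanishes because `g 0 N = 0`.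
  rw [tailTerm, h1, h2, mul_comm, coeff_mul,
    Finset.Nat.sum_antidiagonal_eq_sum_range_succ_mk, Finset.sum_range_succ', partialS,
    Finset.range_eq_Ico, Finset.sum_Ico_add' (fun m => coeff m _ * coeff (n - m) _) 0 n 1]
  have h0 : g 0 N = 0 := by simp [g]
  simp [h0, mul_comm, Finset.Ico_add_one_right_eq_Icc]

/-- Convergence is coefficientwise, and the coefficient of `X ^ n` in `tailTerm N` vanishes once `N
≥ n`. -/
theorem hasSum_tailTerm :
    HasSum (fun n : ℕ+ => tailTerm n) (series fun n => (S n : ℚ)) := by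
  rw [WithPiTopology.hasSum_iff_hasSum_coeff]
  intro n
  have h : coeff n (series fun n => (S n : ℚ)) = ∑ N ∈ Finset.range n, (partialS n N : ℚ) := by
    rw [series, coeff_mk, S_eq_sum_partialS]
    rcases Nat.eq_zero_or_pos n with rfl | hn
    · simp
    · simp [Nat.succ_le_of_lt hn]
  simp only [coeff_tailTerm]
  rw [h]
  refine (PNat.coe_injective.hasSum_iff (f := fun N : ℕ => (partialS n N : ℚ)) fun N hN => ?_).2
    (hasSum_sum_of_ne_finset_zero fun N hN => ?_)
  · obtain rfl : N = 0 := by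
      by_contra h0
      exact hN ⟨⟨N, Nat.pos_of_ne_zero h0⟩, rfl⟩
    simp [partialS_zero_right]
  · rw [partialS_eq_zero (by simpa using hN), Int.cast_zero]

end RankMoment

theorem theorem1p1 :
    Summable (fun n : ℕ+ => RankMoment.tailTerm n) ∧
    RankMoment.series (fun n => (RankMoment.S n : ℚ)) =
      ∑' n : ℕ+, RankMoment.tailTerm n ∧
    ∑' n : ℕ+, RankMoment.tailTerm n =
      RankMoment.series (fun n => (RankMoment.p₂ n : ℚ) - (n : ℚ) * (RankMoment.p n : ℚ)
        - 1 / 2 * (RankMoment.N₂ n : ℚ)) := by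
  have h := RankMoment.hasSum_tailTerm
  refine ⟨h.summable, h.tsum_eq.symm, ?_⟩
  rw [h.tsum_eq]
  simp only [RankMoment.S_eq]
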